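/- A weighted oriented graph $D$ on a finite vertex set $V(D)$ is an orientation of a finite simple graph $G$ (each edge $\{u,v\}$ of $G$ receives exactly one of the directions $(u,v)$, $(v,u)$) together with a weight function $w:V(D)\to\{1,2,3,\dots\}$. Its edge ideal is the ideal $$I(D)=\big\langle\, x_u x_v^{w(v)} \;:\; (u,v)\in E(D)\,\big\rangle\subseteq A=K[x_v : v\in V(D)],$$ where $K$ is a field, and $I(G)=\langle x_u x_v : \{u,v\}\in E(G)\rangle\subseteq A$ is the edge ideal of $G$. An ideal $I$ of $A$ is called Cohen–Macaulay if the ring $A/I$ is Cohen–Macaulay, and unmixed if all its associated primes have the same height. A vertex is a source if it is not isolated and all edges at it are directed away from it; by convention, every source has weight $1$ (changing the weight of a source does not change $I(D)$). Theorem. Let $K$ be a field and let $D$ be a weighted oriented graph, with every source of weight $1$, whose underlying graph $G$ is the triangle $C_3$. Then: (1) $I(D)$ is Cohen–Macaulay if and only if there is a vertex $v\in V(D)$ with $w(v)=1$. (2) $I(D)$ is Cohen–Macaulay if and only if $I(D)$ is unmixed and $I(G)$ is Cohen–Macaulay. -/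

import Mathlib

/-- The depth of a local ring: the supremum of the lengths of the regular sequences contained in
its maximal ideal. -/
noncomputable def localRingDepth (R : Type*) [CommRing R] [IsLocalRing R] : ℕ∞ :=
  ⨆ (rs : List R) (_ : (∀ r ∈ rs, r ∈ IsLocalRing.maximalIdeal R) ∧
    RingTheory.Sequence.IsRegular R rs), (rs.length : ℕ∞)

/-- A commutative ring is Cohen-Macaulay if it is Noetherian and each of its localizations at a
maximal ideal has depth equal to its Krull dimension. -/
def IsCohenMacaulayRing (R : Type*) [CommRing R] : Prop :=
  IsNoetherianRing R ∧ ∀ (m : Ideal R) [m.IsMaximal],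
    (localRingDepth (Localization.AtPrime m) : WithBot ℕ∞) =
      ringKrullDim (Localization.AtPrime m)

/-- An ideal is unmixed if all its associated primes (the associated primes of the quotient
module) have the same height. -/
def IsUnmixedIdeal {A : Type*} [CommRing A] (I : Ideal A) : Prop :=
  ∀ P ∈ associatedPrimes A (A ⧸ I), ∀ Q ∈ associatedPrimes A (A ⧸ I), P.height = Q.height

/-- The edge ideal of a simple graph, in the polynomial ring on its vertices. -/
noncomputable def SimpleGraph.edgeIdeal {V : Type*} (G : SimpleGraph V) (K : Type*) [Field K] :
    Ideal (MvPolynomial V K) :=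
  Ideal.span {f | ∃ u v : V, G.Adj u v ∧ f = MvPolynomial.X u * MvPolynomial.X v}

/-- A weighted oriented graph: every edge of a simple graph carries exactly one of its two
directions, and every vertex a positive integer weight. -/
structure WeightedOrientedGraph (V : Type*) where
  /-- `Arc u v` says that `(u, v)` is a directed edge, from `u` to `v`. -/
  Arc : V → V → Prop
  /-- There are no loops and no pairs of opposite directed edges. -/
  asymm : ∀ u v, Arc u v → ¬ Arc v u
  /-- The weight function. -/
  weight : V → ℕ
  weight_pos : ∀ v, 0 < weight v

namespace WeightedOrientedGraph

variable {V : Type*} (D : WeightedOrientedGraph V)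

/-- The underlying simple graph. -/
def underlying : SimpleGraph V where
  Adj u v := D.Arc u v ∨ D.Arc v u
  symm := ⟨fun _ _ h => h.symm⟩
  loopless := ⟨fun v h => h.elim (fun h => D.asymm v v h h) (fun h => D.asymm v v h h)⟩

/-- A source: a non-isolated vertex all of whose edges are directed away from it. -/
def IsSource (v : V) : Prop :=
  (∃ u, D.underlying.Adj u v) ∧ ∀ u, D.underlying.Adj u v → D.Arc v u

/-- The edge ideal, generated by the monomials `x_u * x_v ^ w(v)` for directed edges `(u, v)`. -/
noncomputable def edgeIdeal (K : Type*) [Field K] : Ideal (MvPolynomial V K) :=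
  Ideal.span {f | ∃ u v : V, D.Arc u v ∧
    f = MvPolynomial.X u * MvPolynomial.X v ^ D.weight v}

end WeightedOrientedGraph

/-!
The theorem is decided by whether the maximal ideal of the variables is associated to the edge
ideal `I`.

If all weights are at least two, there is no source, so every vertex `v` is the head of an arc
`(u, v)`. Then `∏ x_v ^ (w(v) - 1)` is outside `I` but every variable multiplies it into `I`. The
quotient therefore has depth zero at the origin (`localRingDepth_eq_zero`), while `I` lies in the
smaller prime `(x, y)`, so that it has positive dimension there. The maximal ideal is an associated
prime of larger height than a minimal prime of `I`, so `I` is not unmixed either.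

If some vertex has weight one, then a suitable listing `x, y, z` of the vertices makes `I` an
intersection of ideals `(x ^ i, y ^ j)`, `(x ^ k, z ^ l)`, `(y ^ m, z ^ n)`. These are primary to
`(x, y)`, `(x, z)`, `(y, z)` (`mem_varPowIdeal_of_mul_mem`), primes of equal height over which there
are only maximal ideals. So these three primes contain all zero divisors modulo `I`; they are the
only possible associated primes (`associatedPrimes_quotient_subset`), and prime avoidance gives a
regular element in every maximal ideal of the one-dimensional quotient, which is Cohen-Macaulay
(`isCohenMacaulayRing_quotient_of_forall_prime`). The edge ideal of the triangle itself is the case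
in which all weights are one, so it is always Cohen-Macaulay, and both equivalences follow.
-/

/-! ### Depth and dimension -/

theorem localRingDepth_le_ringKrullDim (R : Type*) [CommRing R] [IsLocalRing R]
    [IsNoetherianRing R] : (localRingDepth R : WithBot ℕ∞) ≤ ringKrullDim R := by
  obtain ⟨d, hd⟩ := WithBot.ne_bot_iff_exists.mp (ringKrullDim_ne_bot (R := R))
  rw [← hd, WithBot.coe_le_coe]
  refine iSup₂_le fun rs hrs => ?_
  have h := ringKrullDim_add_length_eq_ringKrullDim_of_isRegular rs hrs.2
  have hnt : Nontrivial (R ⧸ Ideal.ofList rs) := by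
    refine Ideal.Quotient.nontrivial_iff.mpr fun htop => hrs.2.top_ne_smul ?_
    simp [htop]
  have h0 : (0 : WithBot ℕ∞) ≤ ringKrullDim (R ⧸ Ideal.ofList rs) :=
    ringKrullDim_nonneg_of_nontrivial
  have h1 : ((rs.length : ℕ∞) : WithBot ℕ∞) ≤ (d : WithBot ℕ∞) := by
    rw [hd, ← h]
    simpa using add_le_add_left h0 ((rs.length : ℕ∞) : WithBot ℕ∞)
  exact WithBot.coe_le_coe.mp h1

theorem one_le_localRingDepth {R : Type*} [CommRing R] [IsLocalRing R] [IsNoetherianRing R] {r : R}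
    (hr : r ∈ nonZeroDivisors R) (hm : r ∈ IsLocalRing.maximalIdeal R) :
    1 ≤ localRingDepth R := by
  have h : (∀ s ∈ [r], s ∈ IsLocalRing.maximalIdeal R) ∧ RingTheory.Sequence.IsRegular R [r] := by
    have h1 : ∀ s ∈ [r], s ∈ IsLocalRing.maximalIdeal R := by simpa using hm
    refine ⟨h1, (IsLocalRing.isRegular_iff_isWeaklyRegular_of_subset_maximalIdeal h1).mpr ?_⟩
    rw [RingTheory.Sequence.isWeaklyRegular_singleton_iff]
    exact Module.Flat.isSMulRegular_of_nonZeroDivisors hr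
  exact le_iSup₂_of_le (f := fun (rs : List R) _ => (rs.length : ℕ∞)) [r] h (by simp)

/-- A local ring whose maximal ideal is killed by a nonzero element has depth zero, since then no
element of the maximal ideal is regular. -/
theorem localRingDepth_eq_zero {R : Type*} [CommRing R] [IsLocalRing R] {s : R} (hs : s ≠ 0)
    (h : ∀ r ∈ IsLocalRing.maximalIdeal R, r * s = 0) : localRingDepth R = 0 := by
  refine le_antisymm (iSup₂_le fun rs hrs => ?_) bot_le
  match rs, hrs with
  | [], _ => simp
  | r :: rs, ⟨h1, h2⟩ =>
    have h3 := ((RingTheory.Sequence.isWeaklyRegular_cons_iff R r rs).mp h2.toIsWeaklyRegular).1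
    refine absurd (h3 (?_ : r • s = r • 0)) hs
    simpa using h r (h1 r (by simp))

/-! ### Quotients of dimension one and their associated primes -/

/-- Prime avoidance, for a finite set of primes. -/
theorem Ideal.exists_mem_forall_notMem {A : Type*} [CommRing A] {S : Finset (Ideal A)}
    (hprime : ∀ p ∈ S, p.IsPrime) {J : Ideal A} (hJ : ∀ p ∈ S, ¬ J ≤ p) :
    ∃ f ∈ J, ∀ p ∈ S, f ∉ p := by
  by_contra! h
  have h1 : (J : Set A) ⊆ ⋃ p ∈ (S : Set (Ideal A)), (p : Set A) := fun f hf => by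
    obtain ⟨p, hp, hfp⟩ := h f hf
    exact Set.mem_biUnion hp hfp
  obtain ⟨p, hp, hle⟩ := (Ideal.subset_union_prime (f := id) ⊥ ⊥
    (fun p hp _ _ => hprime p hp)).mp h1
  exact hJ p hp hle

section OneDimensional

variable {A : Type*} [CommRing A] [IsNoetherianRing A] {I : Ideal A} {S : Finset (Ideal A)}

/-- If every element outside a finite set `S` of primes is regular modulo `I`, if every prime
over `I` contains a member of `S`, and if the members of `S` are not maximal but every prime
properly containing one of them is, then `A ⧸ I` is Cohen-Macaulay: it has dimension one at each maximal ideal, and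
prime avoidance provides a regular element there. -/
theorem isCohenMacaulayRing_quotient_of_forall_prime (hprime : ∀ p ∈ S, p.IsPrime)
    (hnmax : ∀ p ∈ S, ¬ p.IsMaximal) (hmax : ∀ p ∈ S, ∀ q : Ideal A, q.IsPrime → p < q → q.IsMaximal)
    (hmin : ∀ q : Ideal A, q.IsPrime → I ≤ q → ∃ p ∈ S, p ≤ q)
    (hreg : ∀ f, (∀ p ∈ S, f ∉ p) → ∀ g, f * g ∈ I → g ∈ I) :
    IsCohenMacaulayRing (A ⧸ I) := by
  have hdim : Ring.KrullDimLE 1 (A ⧸ I) := by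
    refine Ring.krullDimLE_one_iff.mpr fun P hP => ?_
    have hle : ∀ P : Ideal (A ⧸ I), I ≤ P.comap (Ideal.Quotient.mk I) := fun P => by
      conv_lhs => rw [← Ideal.mk_ker (I := I)]
      exact Ideal.comap_mono bot_le
    by_cases h : ∃ p ∈ S, p < P.comap (Ideal.Quotient.mk I)
    · obtain ⟨p, hp, hlt⟩ := h
      have := hmax p hp _ (Ideal.comap_isPrime _ _) hlt
      right
      rw [← Ideal.map_comap_of_surjective _ Ideal.Quotient.mk_surjective P]
      refine Ideal.IsMaximal.map_of_surjective_of_ker_le Ideal.Quotient.mk_surjective ?_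
      rw [Ideal.mk_ker]
      exact hle P
    · left
      refine ⟨⟨hP, bot_le⟩, fun Q hQ hQP => ?_⟩
      have := hQ.1
      obtain ⟨p, hp, hpQ⟩ := hmin _ (Ideal.comap_isPrime (Ideal.Quotient.mk I) Q) (hle Q)
      have h1 := hpQ.trans (Ideal.comap_mono hQP)
      have h2 := h1.eq_of_not_lt fun hlt => h ⟨p, hp, hlt⟩
      exact (Ideal.comap_le_comap_iff_of_surjective _ Ideal.Quotient.mk_surjective _ _).mp
        (h2 ▸ hpQ)
  refine ⟨inferInstance, fun m hm => ?_⟩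
  obtain ⟨f, hf, hfS⟩ := Ideal.exists_mem_forall_notMem hprime
    (J := m.comap (Ideal.Quotient.mk I)) fun p hp hle =>
      hnmax p hp <| (Ideal.comap_isMaximal_of_surjective _ Ideal.Quotient.mk_surjective).eq_of_le
        (hprime p hp).ne_top hle ▸ Ideal.comap_isMaximal_of_surjective _
          Ideal.Quotient.mk_surjective
  have hnzd : Ideal.Quotient.mk I f ∈ nonZeroDivisors (A ⧸ I) := by
    rw [mem_nonZeroDivisors_iff_right]
    intro g hg
    obtain ⟨g, rfl⟩ := Ideal.Quotient.mk_surjective g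
    rw [← map_mul, Ideal.Quotient.eq_zero_iff_mem, mul_comm] at hg
    exact Ideal.Quotient.eq_zero_iff_mem.mpr (hreg f hfS g hg)
  have h1 : 1 ≤ localRingDepth (Localization.AtPrime m) := by
    refine one_le_localRingDepth
      (r := algebraMap (A ⧸ I) (Localization.AtPrime m) (Ideal.Quotient.mk I f)) ?_ ?_
    · exact IsLocalization.map_nonZeroDivisors_le m.primeCompl _
        (Submonoid.mem_map_of_mem _ hnzd)
    · exact (IsLocalization.AtPrime.to_map_mem_maximal_iff _ m _).mpr hf
  refine le_antisymm (localRingDepth_le_ringKrullDim _) (le_trans ?_ (WithBot.coe_le_coe.mpr h1))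
  rw [IsLocalization.AtPrime.ringKrullDim_eq_height m]
  exact Ideal.height_le_ringKrullDim_of_ne_top hm.ne_top |>.trans
    (Order.krullDimLE_iff _ _ |>.mp hdim)

/-- Under the hypotheses of `isCohenMacaulayRing_quotient_of_forall_prime`, the associated primes
of `A ⧸ I` belong to `S`. -/
theorem associatedPrimes_quotient_subset (hprime : ∀ p ∈ S, p.IsPrime)
    (hnmax : ∀ p ∈ S, ¬ p.IsMaximal) (hmax : ∀ p ∈ S, ∀ q : Ideal A, q.IsPrime → p < q → q.IsMaximal)
    (hmin : ∀ q : Ideal A, q.IsPrime → I ≤ q → ∃ p ∈ S, p ≤ q)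
    (hreg : ∀ f, (∀ p ∈ S, f ∉ p) → ∀ g, f * g ∈ I → g ∈ I) :
    associatedPrimes A (A ⧸ I) ⊆ S := by
  intro P hP
  obtain ⟨hPp, g, hg⟩ := isAssociatedPrime_iff.mp hP
  obtain ⟨g, rfl⟩ := Ideal.Quotient.mk_surjective g
  have hmem : ∀ f, f ∈ P ↔ f * g ∈ I := fun f => by
    rw [hg, Submodule.mem_colon_singleton, Submodule.mem_bot, ← Ideal.Quotient.eq_zero_iff_mem,
      map_mul, Algebra.smul_def]
    rfl
  have hgI : g ∉ I := fun h => hPp.ne_top <| (Ideal.eq_top_iff_one P).mpr <| by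
    rwa [hmem, one_mul]
  obtain ⟨p, hp, hPle⟩ : ∃ p ∈ S, P ≤ p := by
    by_contra! h
    obtain ⟨f, hf, hfS⟩ := Ideal.exists_mem_forall_notMem hprime h
    exact hgI (hreg f hfS g ((hmem f).mp hf))
  obtain ⟨p', hp', hle⟩ := hmin P hPp fun f hf => (hmem f).mpr (I.mul_mem_right g hf)
  have h1 := (hle.trans hPle).eq_of_not_lt fun hlt => hnmax p hp (hmax p' hp' p (hprime p hp) hlt)
  have h2 : P = p := le_antisymm hPle (h1 ▸ hle)
  exact h2 ▸ hp

end OneDimensional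

/-- If some `g ∉ I` is multiplied into `I` by a maximal ideal `M`, and if `I` lies in a prime
properly contained in `M`, then `A ⧸ I` has depth zero but positive dimension at `M`. -/
theorem not_isCohenMacaulayRing_quotient {A : Type*} [CommRing A] {I M p : Ideal A} [M.IsMaximal]
    [p.IsPrime] (hIp : I ≤ p) (hpM : p < M) {g : A} (hg : g ∉ I) (hM : ∀ f ∈ M, f * g ∈ I) :
    ¬ IsCohenMacaulayRing (A ⧸ I) := by
  rintro ⟨-, hCM⟩
  have hker : ∀ {J : Ideal A}, I ≤ J → RingHom.ker (Ideal.Quotient.mk I) ≤ J := fun h => by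
    rwa [Ideal.mk_ker]
  have hsurj : Function.Surjective (Ideal.Quotient.mk I) := Ideal.Quotient.mk_surjective
  have hcomap : ∀ {J : Ideal A}, I ≤ J →
      (J.map (Ideal.Quotient.mk I)).comap (Ideal.Quotient.mk I) = J := fun h => by
    rw [Ideal.comap_map_of_surjective' _ hsurj, sup_eq_left]
    exact hker h
  have hm : (M.map (Ideal.Quotient.mk I)).IsMaximal :=
    Ideal.IsMaximal.map_of_surjective_of_ker_le hsurj (hker (hIp.trans hpM.le))
  have hq : (p.map (Ideal.Quotient.mk I)).IsPrime :=
    Ideal.map_isPrime_of_surjective hsurj (hker hIp)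
  have hlt : p.map (Ideal.Quotient.mk I) < M.map (Ideal.Quotient.mk I) := by
    refine lt_of_le_of_ne (Ideal.map_mono hpM.le) fun h => hpM.ne ?_
    rw [← hcomap hIp, h, hcomap (hIp.trans hpM.le)]
  set m := M.map (Ideal.Quotient.mk I)
  have hkill : ∀ r ∈ m, r * Ideal.Quotient.mk I g = 0 := fun r hr => by
    obtain ⟨f, hf, rfl⟩ := (Ideal.mem_map_iff_of_surjective _ hsurj).mp hr
    rw [← map_mul]
    exact Ideal.Quotient.eq_zero_iff_mem.mpr (hM f hf)
  have hdepth : localRingDepth (Localization.AtPrime m) = 0 := by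
    refine localRingDepth_eq_zero
      (s := algebraMap (A ⧸ I) (Localization.AtPrime m) (Ideal.Quotient.mk I g)) ?_ ?_
    · rw [Ne, IsLocalization.map_eq_zero_iff m.primeCompl]
      rintro ⟨⟨c, hc⟩, hcg⟩
      obtain ⟨c, rfl⟩ := hsurj c
      have hcM : c ∉ M := fun h => hc (Ideal.mem_map_of_mem _ h)
      -- Modulo `M` the element `c` is a unit, so `c * g ∈ I` and `M * g ⊆ I` give `g ∈ I`.
      obtain ⟨b, n, hn, hbn⟩ := ‹M.IsMaximal›.exists_inv hcM
      refine hg ?_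
      rw [show g = b * (c * g) + n * g by linear_combination (-g) * hbn]
      refine I.add_mem (I.mul_mem_left _ ?_) (hM n hn)
      rw [← Ideal.Quotient.eq_zero_iff_mem, map_mul]
      exact hcg
    · intro r hr
      obtain ⟨a, c, rfl⟩ := IsLocalization.exists_mk'_eq m.primeCompl r
      have ha : a ∈ m :=
        (IsLocalization.AtPrime.mk'_mem_maximal_iff (Localization.AtPrime m) m a c).mp hr
      rw [IsLocalization.mk'_eq_mul_mk'_one, mul_right_comm, ← map_mul, hkill a ha, map_zero,
        zero_mul]
  have h := hCM m
  rw [hdepth, IsLocalization.AtPrime.ringKrullDim_eq_height m] at h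
  have h0 : m.height = 0 := (WithBot.coe_injective h).symm
  exact hlt.not_ge ((Ideal.height_eq_zero_iff.mp h0).2 ⟨hq, bot_le⟩ hlt.le)

/-- Under the hypotheses of `not_isCohenMacaulayRing_quotient`, the maximal ideal `M` is an
associated prime of `A ⧸ I`, and so is a minimal prime of `I` below `p`; the latter has smaller
height. -/
theorem not_isUnmixedIdeal {A : Type*} [CommRing A] [IsNoetherianRing A] {I M p : Ideal A}
    [M.IsMaximal] [p.IsPrime] (hIp : I ≤ p) (hpM : p < M) {g : A} (hg : g ∉ I)
    (hM : ∀ f ∈ M, f * g ∈ I) : ¬ IsUnmixedIdeal I := by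
  intro h
  obtain ⟨q, hq, hqp⟩ := Ideal.exists_minimalPrimes_le hIp
  have hqA : q ∈ associatedPrimes A (A ⧸ I) := by
    refine Module.associatedPrimes.minimalPrimes_annihilator_subset_associatedPrimes A _ ?_
    rwa [Ideal.annihilator_quotient]
  have hMA : M ∈ associatedPrimes A (A ⧸ I) := by
    refine isAssociatedPrime_iff.mpr ⟨inferInstance, Ideal.Quotient.mk I g, ?_⟩
    refine ‹M.IsMaximal›.eq_of_le ?_ fun f hf => ?_
    · rw [Ne, Ideal.eq_top_iff_one, Submodule.mem_colon_singleton, one_smul, Submodule.mem_bot]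
      exact fun h => hg (Ideal.Quotient.eq_zero_iff_mem.mp h)
    · rw [Submodule.mem_colon_singleton, Submodule.mem_bot]
      exact Ideal.Quotient.eq_zero_iff_mem.mpr (hM f hf)
  have := hq.1.1
  exact (Ideal.height_strict_mono_of_isPrime_of_isPrime (hqp.trans_lt hpM)).ne (h q hqA M hMA)

open MvPolynomial

/-! ### Ideals generated by powers of two variables -/

section TwoVariables

variable {K V : Type*} [Field K]

/-- The ideal `(x ^ i, y ^ j)` of a polynomial ring, for two variables `x` and `y`. -/
noncomputable def varPowIdeal (K : Type*) [Field K] {V : Type*} (x y : V) (i j : ℕ) :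
    Ideal (MvPolynomial V K) :=
  Ideal.span {X x ^ i, X y ^ j}

theorem mem_varPowIdeal {x y : V} {i j : ℕ} {f : MvPolynomial V K} :
    f ∈ varPowIdeal K x y i j ↔ ∀ m ∈ f.support, i ≤ m x ∨ j ≤ m y := by
  have h : ({X x ^ i, X y ^ j} : Set (MvPolynomial V K)) =
      (fun s => monomial s 1) '' {Finsupp.single x i, Finsupp.single y j} := by
    simp [Set.image_pair, X_pow_eq_monomial]
  rw [varPowIdeal, h, mem_ideal_span_monomial_image]
  simp

/-- The ideal `(x ^ i, y ^ j)` is `(x, y)`-primary. Among the monomials of `g` outside the ideal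
take those of least degree in `x` and `y`, and among the monomials of `f` those free of `x` and
`y`; the sums of their exponents include one that arises in only one way, and the corresponding
monomial of `f * g` is outside the ideal. -/
theorem mem_varPowIdeal_of_mul_mem {x y : V} {i j : ℕ} {f g : MvPolynomial V K}
    (hf : f ∉ varPowIdeal K x y 1 1) (h : f * g ∈ varPowIdeal K x y i j) :
    g ∈ varPowIdeal K x y i j := by
  classical
  by_contra hg
  rw [mem_varPowIdeal] at hf hg h
  push Not at hf hg
  obtain ⟨a, ha, hax, hay⟩ := hf
  obtain ⟨b, hb, hbx, hby⟩ := hg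
  obtain ⟨m, hm, hmin⟩ := (g.support.filter fun m => m x < i ∧ m y < j).exists_min_image
    (fun m => m x + m y) ⟨b, by simp_all⟩
  obtain ⟨a₀, ha₀, b₀, hb₀, huniq⟩ := UniqueSums.uniqueAdd_of_nonempty
    (A := f.support.filter fun m => m x = 0 ∧ m y = 0)
    (B := g.support.filter fun n => (n x < i ∧ n y < j) ∧ n x + n y ≤ m x + m y)
    ⟨a, by rw [Finset.mem_filter]; exact ⟨ha, by omega, by omega⟩⟩
    ⟨m, by rw [Finset.mem_filter] at hm ⊢; exact ⟨hm.1, hm.2, le_rfl⟩⟩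
  rw [Finset.mem_filter] at ha₀ hb₀
  obtain ⟨ha₀, ha₀x, ha₀y⟩ := ha₀
  obtain ⟨hb₀, ⟨hb₀x, hb₀y⟩, hb₀m⟩ := hb₀
  have hcoeff : coeff (a₀ + b₀) (f * g) = coeff a₀ f * coeff b₀ g := by
    rw [coeff_mul]
    refine Finset.sum_eq_single_of_mem (a₀, b₀) (by simp) ?_
    rintro ⟨c, d⟩ hcd hne
    rw [Finset.HasAntidiagonal.mem_antidiagonal] at hcd
    dsimp only at hcd ⊢
    by_contra h0
    obtain ⟨hc, hd⟩ := ne_zero_and_ne_zero_of_mul h0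
    rw [← mem_support_iff] at hc hd
    have hx := DFunLike.congr_fun hcd x
    have hy := DFunLike.congr_fun hcd y
    rw [Finsupp.add_apply, Finsupp.add_apply] at hx hy
    have hd' := hmin d (Finset.mem_filter.mpr ⟨hd, by omega, by omega⟩)
    obtain ⟨rfl, rfl⟩ := huniq (Finset.mem_filter.mpr ⟨hc, by omega, by omega⟩)
      (Finset.mem_filter.mpr ⟨hd, ⟨by omega, by omega⟩, by omega⟩) hcd
    exact hne rfl
  have := h (a₀ + b₀) <| by
    rw [mem_support_iff, hcoeff]
    exact mul_ne_zero (mem_support_iff.mp ha₀) (mem_support_iff.mp hb₀)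
  rw [Finsupp.add_apply, Finsupp.add_apply] at this
  omega

theorem X_notMem_varPowIdeal {x y z : V} (hx : x ≠ z) (hy : y ≠ z) :
    (X z : MvPolynomial V K) ∉ varPowIdeal K x y 1 1 := by
  rw [mem_varPowIdeal]
  simp [support_X, hx.symm, hy.symm]

theorem isPrime_varPowIdeal {x y z : V} (hx : x ≠ z) (hy : y ≠ z) :
    (varPowIdeal K x y 1 1).IsPrime where
  ne_top' h := X_notMem_varPowIdeal (K := K) hx hy (h ▸ Submodule.mem_top)
  mem_or_mem' {_ _} h := or_iff_not_imp_left.mpr fun hf => mem_varPowIdeal_of_mul_mem hf h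

theorem varPowIdeal_le_of_isPrime {x y : V} {i j : ℕ} {P : Ideal (MvPolynomial V K)} (hP : P.IsPrime)
    (h : varPowIdeal K x y i j ≤ P) : varPowIdeal K x y 1 1 ≤ P := by
  rw [varPowIdeal, Ideal.span_le, Set.pair_subset_iff] at h ⊢
  rw [pow_one, pow_one]
  exact ⟨hP.mem_of_pow_mem _ h.1, hP.mem_of_pow_mem _ h.2⟩

instance isMaximal_idealOfVars : (idealOfVars V K).IsMaximal := by
  have h : idealOfVars V K = RingHom.ker (constantCoeff (σ := V) (R := K)) := by
    ext f
    rw [← pow_one (idealOfVars V K), mem_pow_idealOfVars_iff, RingHom.mem_ker,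
      constantCoeff_eq, ← notMem_support_iff]
    refine ⟨fun h h0 => ?_, fun h m hm => Nat.one_le_iff_ne_zero.mpr fun h0 => h ?_⟩
    · simpa using h 0 h0
    · rwa [(Finsupp.degree_eq_zero_iff m).mp h0] at hm
  rw [h]
  exact RingHom.ker_isMaximal_of_surjective _ fun c => ⟨C c, constantCoeff_C _ c⟩

theorem varPowIdeal_lt_idealOfVars {x y z : V} (hx : x ≠ z) (hy : y ≠ z) :
    varPowIdeal K x y 1 1 < idealOfVars V K := by
  refine lt_of_le_of_ne ?_ fun h => X_notMem_varPowIdeal (K := K) hx hy (h ▸ ?_)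
  · rw [varPowIdeal, Ideal.span_le, Set.pair_subset_iff, pow_one, pow_one]
    exact ⟨Ideal.subset_span ⟨x, rfl⟩, Ideal.subset_span ⟨y, rfl⟩⟩
  · exact Ideal.subset_span ⟨z, rfl⟩

/-- In three variables, the quotient by `(x, y)` is a quotient of the polynomial ring in the third
variable `z`, hence has dimension at most one. -/
theorem isMaximal_of_varPowIdeal_lt {x y z : V} (hx : x ≠ z) (hy : y ≠ z)
    (hV : ∀ v, v = x ∨ v = y ∨ v = z) {q : Ideal (MvPolynomial V K)} (hq : q.IsPrime)
    (h : varPowIdeal K x y 1 1 < q) : q.IsMaximal := by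
  let φ : Polynomial K →+* MvPolynomial V K := (Polynomial.aeval (X z)).toRingHom
  have hφ : ∀ f, ∃ p, f - φ p ∈ varPowIdeal K x y 1 1 := by
    intro f
    induction f using MvPolynomial.induction_on with
    | C a => exact ⟨Polynomial.C a, by simp [φ, algebraMap_eq]⟩
    | add f g hf hg =>
      obtain ⟨p, hp⟩ := hf
      obtain ⟨r, hr⟩ := hg
      refine ⟨p + r, ?_⟩
      rw [map_add, add_sub_add_comm]
      exact Ideal.add_mem _ hp hr
    | mul_X f v hf =>
      rcases hV v with rfl | rfl | rfl
      · refine ⟨0, ?_⟩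
        rw [map_zero, sub_zero]
        exact Ideal.mul_mem_left _ _ (Ideal.subset_span (by simp))
      · refine ⟨0, ?_⟩
        rw [map_zero, sub_zero]
        exact Ideal.mul_mem_left _ _ (Ideal.subset_span (by simp))
      · obtain ⟨p, hp⟩ := hf
        refine ⟨p * Polynomial.X, ?_⟩
        rw [map_mul, show φ Polynomial.X = X v by simp [φ], ← sub_mul]
        exact Ideal.mul_mem_right _ _ hp
  have hmem : ∀ {f p}, f - φ p ∈ varPowIdeal K x y 1 1 → (f ∈ q ↔ p ∈ q.comap φ) := fun {f p} hp => by
    rw [Ideal.mem_comap, ← Ideal.add_mem_iff_right q (b := φ p) (h.le hp), sub_add_cancel]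
  have hbot : q.comap φ ≠ ⊥ := fun hbot => by
    obtain ⟨f, hfq, hf⟩ := SetLike.exists_of_lt h
    obtain ⟨p, hp⟩ := hφ f
    have h0 := (hmem hp).mp hfq
    rw [hbot, Ideal.mem_bot] at h0
    rw [h0, map_zero, sub_zero] at hp
    exact hf hp
  have hmax : (q.comap φ).IsMaximal :=
    IsPrime.to_maximal_ideal (S := q.comap φ) hbot
  refine Ideal.isMaximal_iff.mpr ⟨fun h1 => hq.ne_top ((Ideal.eq_top_iff_one q).mpr h1), ?_⟩
  intro J f hJ hfq hfJ
  obtain ⟨p, hp⟩ := hφ f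
  obtain ⟨b, n, hn, hbn⟩ := hmax.exists_inv fun hpq => hfq ((hmem hp).mpr hpq)
  rw [← map_one φ, ← hbn, map_add, map_mul]
  refine J.add_mem (J.mul_mem_left _ ?_) (hJ hn)
  rw [← sub_sub_cancel f (φ p)]
  exact J.sub_mem hfJ (hJ (h.le hp))

theorem height_varPowIdeal_eq {x y x' y' : V} (e : V ≃ V) (hx : e x = x') (hy : e y = y') :
    (varPowIdeal K x y 1 1).height = (varPowIdeal K x' y' 1 1).height := by
  have h : (varPowIdeal K x y 1 1).map (renameEquiv K e).toRingEquiv =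
      varPowIdeal K x' y' 1 1 := by
    rw [varPowIdeal, Ideal.map_span, varPowIdeal, Set.image_pair]
    simp [← hx, ← hy]
  rw [← h, RingEquiv.height_map]

end TwoVariables

/-! ### Intersections of three primary ideals in three variables -/

section ThreeVariables

variable {K V : Type*} [Field K]

/-- The primes `(x, y)`, `(x, z)`, `(y, z)` satisfy the hypotheses of
`isCohenMacaulayRing_quotient_of_forall_prime`, and permutations of the variables show that they
have the same height. -/
theorem isCohenMacaulayRing_and_isUnmixedIdeal_of_eq_inf {x y z : V} (hxy : x ≠ y) (hxz : x ≠ z)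
    (hyz : y ≠ z) (hV : ∀ v, v = x ∨ v = y ∨ v = z) {i j k l m n : ℕ}
    {I : Ideal (MvPolynomial V K)}
    (hI : I = varPowIdeal K x y i j ⊓ varPowIdeal K x z k l ⊓ varPowIdeal K y z m n) :
    IsCohenMacaulayRing (MvPolynomial V K ⧸ I) ∧ IsUnmixedIdeal I := by
  classical
  have : Finite V := (Set.toFinite {x, y, z}).subset
    (fun v _ => by simpa using hV v) |>.to_subtype.of_equiv _ (Equiv.Set.univ V)
  let S : Finset (Ideal (MvPolynomial V K)) :=
    {varPowIdeal K x y 1 1, varPowIdeal K x z 1 1, varPowIdeal K y z 1 1}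
  have hS : ∀ {motive : Ideal (MvPolynomial V K) → Prop},
      (∀ u v w, u ≠ w → v ≠ w → (∀ a, a = u ∨ a = v ∨ a = w) → motive (varPowIdeal K u v 1 1)) →
        ∀ p ∈ S, motive p := by
    intro motive h p hp
    simp only [S, Finset.mem_insert, Finset.mem_singleton] at hp
    rcases hp with rfl | rfl | rfl
    · exact h x y z hxz hyz hV
    · exact h x z y hxy hyz.symm fun v => by have := hV v; tauto
    · exact h y z x hxy.symm hxz.symm fun v => by have := hV v; tauto
  have hprime : ∀ p ∈ S, p.IsPrime := hS fun u v w h1 h2 _ => isPrime_varPowIdeal h1 h2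
  have hnmax : ∀ p ∈ S, ¬ p.IsMaximal := hS fun u v w h1 h2 _ hmax =>
    (varPowIdeal_lt_idealOfVars (K := K) h1 h2).ne
      (hmax.eq_of_le isMaximal_idealOfVars.ne_top (varPowIdeal_lt_idealOfVars h1 h2).le)
  have hmax : ∀ p ∈ S, ∀ q : Ideal (MvPolynomial V K), q.IsPrime → p < q → q.IsMaximal :=
    hS fun u v w h1 h2 h3 q hq hlt => isMaximal_of_varPowIdeal_lt h1 h2 h3 hq hlt
  have hmin : ∀ q : Ideal (MvPolynomial V K), q.IsPrime → I ≤ q → ∃ p ∈ S, p ≤ q := by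
    intro q hq hle
    rw [hI, hq.inf_le, hq.inf_le] at hle
    rcases hle with (h | h) | h
    · exact ⟨_, by simp [S], varPowIdeal_le_of_isPrime hq h⟩
    · exact ⟨_, by simp [S], varPowIdeal_le_of_isPrime hq h⟩
    · exact ⟨_, by simp [S], varPowIdeal_le_of_isPrime hq h⟩
  have hreg : ∀ f, (∀ p ∈ S, f ∉ p) → ∀ g, f * g ∈ I → g ∈ I := by
    intro f hf g hfg
    rw [hI] at hfg ⊢
    exact ⟨⟨mem_varPowIdeal_of_mul_mem (hf _ (by simp [S])) hfg.1.1,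
      mem_varPowIdeal_of_mul_mem (hf _ (by simp [S])) hfg.1.2⟩,
      mem_varPowIdeal_of_mul_mem (hf _ (by simp [S])) hfg.2⟩
  refine ⟨isCohenMacaulayRing_quotient_of_forall_prime hprime hnmax hmax hmin hreg, ?_⟩
  have hheight : ∀ p ∈ S, p.height = (varPowIdeal K x y 1 1).height := by
    intro p hp
    simp only [S, Finset.mem_insert, Finset.mem_singleton] at hp
    rcases hp with rfl | rfl | rfl
    · rfl
    · exact height_varPowIdeal_eq (Equiv.swap y z) (Equiv.swap_apply_of_ne_of_ne hxy hxz)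
        (Equiv.swap_apply_right y z)
    · rw [varPowIdeal, Set.pair_comm]
      exact height_varPowIdeal_eq (Equiv.swap x z) (Equiv.swap_apply_right x z)
        (Equiv.swap_apply_of_ne_of_ne hxy.symm hyz)
  have hass := associatedPrimes_quotient_subset hprime hnmax hmax hmin hreg
  exact fun P hP Q hQ => (hheight P (hass hP)).trans (hheight Q (hass hQ)).symm

end ThreeVariables

/-! ### Edge ideals of weighted oriented triangles -/

namespace WeightedOrientedGraph

variable {V : Type*} (D : WeightedOrientedGraph V) {K : Type*} [Field K]

theorem mem_edgeIdeal {f : MvPolynomial V K} :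
    f ∈ D.edgeIdeal K ↔
      ∀ m ∈ f.support, ∃ u v, D.Arc u v ∧ 1 ≤ m u ∧ D.weight v ≤ m v := by
  classical
  have hmon : ∀ u v, (monomial (Finsupp.single u 1 + Finsupp.single v (D.weight v)) 1 :
      MvPolynomial V K) = X u * X v ^ D.weight v := fun u v => by
    rw [X_pow_eq_monomial, X, monomial_mul, one_mul]
  have h : {f : MvPolynomial V K | ∃ u v : V, D.Arc u v ∧ f = X u * X v ^ D.weight v} =
      (fun s => monomial s 1) ''
        {s | ∃ u v, D.Arc u v ∧ s = Finsupp.single u 1 + Finsupp.single v (D.weight v)} := by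
    ext f
    constructor
    · rintro ⟨u, v, huv, rfl⟩
      exact ⟨_, ⟨u, v, huv, rfl⟩, hmon u v⟩
    · rintro ⟨_, ⟨u, v, huv, rfl⟩, rfl⟩
      exact ⟨u, v, huv, hmon u v⟩
  have hle : ∀ {u v} (m : V →₀ ℕ), D.Arc u v →
      (Finsupp.single u 1 + Finsupp.single v (D.weight v) ≤ m ↔
        1 ≤ m u ∧ D.weight v ≤ m v) := by
    intro u v m huv
    have hne : u ≠ v := by rintro rfl; exact D.asymm u u huv huv
    refine ⟨fun h => ⟨?_, ?_⟩, fun h w => ?_⟩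
    · simpa [hne.symm] using h u
    · simpa [hne] using h v
    · rcases eq_or_ne w u with rfl | hu
      · simpa [hne.symm] using h.1
      · rcases eq_or_ne w v with rfl | hv
        · simpa [hne] using h.2
        · simp [hu.symm, hv.symm]
  rw [edgeIdeal, h, mem_ideal_span_monomial_image]
  refine forall₂_congr fun m _ => ⟨?_, ?_⟩
  · rintro ⟨_, ⟨u, v, huv, rfl⟩, h⟩
    exact ⟨u, v, huv, (hle m huv).mp h⟩
  · rintro ⟨u, v, huv, h⟩
    exact ⟨_, ⟨u, v, huv, rfl⟩, (hle m huv).mpr h⟩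

section Triangle

variable {D}

theorem arc_or_arc (hC : Nonempty (D.underlying ≃g SimpleGraph.cycleGraph 3)) {u v : V}
    (h : u ≠ v) : D.Arc u v ∨ D.Arc v u := by
  obtain ⟨e⟩ := hC
  have hadj : ∀ i j : Fin 3, i ≠ j → (SimpleGraph.cycleGraph 3).Adj i j := by decide
  exact e.map_adj_iff.mp (hadj _ _ (e.injective.ne h))

theorem exists_triangle (hC : Nonempty (D.underlying ≃g SimpleGraph.cycleGraph 3)) (x : V) :
    ∃ y z, x ≠ y ∧ x ≠ z ∧ y ≠ z ∧ ∀ v, v = x ∨ v = y ∨ v = z := by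
  obtain ⟨e⟩ := hC
  have h : ∀ i : Fin 3, i ≠ i + 1 ∧ i ≠ i + 2 ∧ i + 1 ≠ i + 2 ∧
    ∀ j, j = i ∨ j = i + 1 ∨ j = i + 2 := by decide
  obtain ⟨h1, h2, h3, h4⟩ := h (e x)
  refine ⟨e.symm (e x + 1), e.symm (e x + 2), fun h => h1 ?_, fun h => h2 ?_,
    e.symm.injective.ne h3, fun v => ?_⟩
  · conv_lhs => rw [h, RelIso.apply_symm_apply]
  · conv_lhs => rw [h, RelIso.apply_symm_apply]
  · refine (h4 (e v)).imp (fun h => e.injective h) (Or.imp (fun h => ?_) fun h => ?_)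
    · rw [← h, RelIso.symm_apply_apply]
    · rw [← h, RelIso.symm_apply_apply]

/-- An oriented triangle has a path `x → y → z` that visits all vertices; the third edge either
goes from `x` to `z`, or closes a directed cycle, which may be started at any vertex. -/
theorem exists_path (hC : Nonempty (D.underlying ≃g SimpleGraph.cycleGraph 3)) (a : V) :
    ∃ x y z, x ≠ y ∧ x ≠ z ∧ y ≠ z ∧ (∀ v, v = x ∨ v = y ∨ v = z) ∧ D.Arc x y ∧ D.Arc y z ∧
      (D.Arc x z ∨ D.Arc z x ∧ x = a) := by
  obtain ⟨b, c, hab, hac, hbc, hV⟩ := exists_triangle hC a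
  have key : ∀ x y z, x ≠ y → x ≠ z → y ≠ z → (∀ v, v = x ∨ v = y ∨ v = z) → D.Arc x y →
      D.Arc y z → (D.Arc x z ∨ D.Arc z x ∧ x = a) → ∃ x y z, x ≠ y ∧ x ≠ z ∧ y ≠ z ∧
      (∀ v, v = x ∨ v = y ∨ v = z) ∧ D.Arc x y ∧ D.Arc y z ∧
      (D.Arc x z ∨ D.Arc z x ∧ x = a) :=
    fun x y z h1 h2 h3 h4 h5 h6 h7 => ⟨x, y, z, h1, h2, h3, h4, h5, h6, h7⟩
  have hV1 : ∀ v, v = a ∨ v = c ∨ v = b := fun v => by have := hV v; tauto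
  have hV2 : ∀ v, v = b ∨ v = a ∨ v = c := fun v => by have := hV v; tauto
  have hV3 : ∀ v, v = b ∨ v = c ∨ v = a := fun v => by have := hV v; tauto
  have hV4 : ∀ v, v = c ∨ v = a ∨ v = b := fun v => by have := hV v; tauto
  have hV5 : ∀ v, v = c ∨ v = b ∨ v = a := fun v => by have := hV v; tauto
  rcases arc_or_arc hC hab with h1 | h1 <;> rcases arc_or_arc hC hac with h2 | h2 <;>
    rcases arc_or_arc hC hbc with h3 | h3
  · exact key a b c hab hac hbc hV h1 h3 (.inl h2)
  · exact key a c b hac hab hbc.symm hV1 h2 h3 (.inl h1)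
  · exact key a b c hab hac hbc hV h1 h3 (.inr ⟨h2, rfl⟩)
  · exact key c a b hac.symm hbc.symm hab hV4 h2 h1 (.inl h3)
  · exact key b a c hab.symm hbc hac hV2 h1 h2 (.inl h3)
  · exact key a c b hac hab hbc.symm hV1 h2 h3 (.inr ⟨h1, rfl⟩)
  · exact key b c a hbc hab.symm hac.symm hV3 h3 h2 (.inl h1)
  · exact key c b a hbc.symm hac.symm hab.symm hV5 h3 h1 (.inl h2)

theorem arc_iff_of_path {x y z : V} (hV : ∀ v, v = x ∨ v = y ∨ v = z) (hxy : D.Arc x y)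
    (hyz : D.Arc y z) {p : V → V → Prop} :
    (∃ u v, D.Arc u v ∧ p u v) ↔
      p x y ∨ p y z ∨ (D.Arc x z ∧ p x z) ∨ (D.Arc z x ∧ p z x) := by
  constructor
  · rintro ⟨u, v, huv, h⟩
    have h1 := D.asymm u v huv
    have h2 := D.asymm u u
    rcases hV u with rfl | rfl | rfl <;> rcases hV v with rfl | rfl | rfl <;> tauto
  · rintro (h | h | h | h)
    exacts [⟨x, y, hxy, h⟩, ⟨y, z, hyz, h⟩, ⟨x, z, h⟩, ⟨z, x, h⟩]

/-- For a path `x → y → z` the edge ideal is `(x, y) ∩ (x, z^c) ∩ (y^b, z^c)` if the third edge goes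
from `x` to `z`, and `(x, y) ∩ (x, z^c) ∩ (y^b, z)` if it goes from `z` to `x` and `x` has weight
one; here `b` and `c` are the weights of `y` and `z`. -/
theorem isCohenMacaulayRing_and_isUnmixedIdeal_edgeIdeal
    (hC : Nonempty (D.underlying ≃g SimpleGraph.cycleGraph 3)) {a : V} (ha : D.weight a = 1) :
    IsCohenMacaulayRing (MvPolynomial V K ⧸ D.edgeIdeal K) ∧ IsUnmixedIdeal (D.edgeIdeal K) := by
  obtain ⟨x, y, z, hxy, hxz, hyz, hV, h1, h2, h3⟩ := exists_path hC a
  have hy := D.weight_pos y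
  have hz := D.weight_pos z
  rcases h3 with h3 | ⟨h3, rfl⟩
  · refine isCohenMacaulayRing_and_isUnmixedIdeal_of_eq_inf hxy hxz hyz hV (i := 1) (j := 1)
      (k := 1) (l := D.weight z) (m := D.weight y) (n := D.weight z) ?_
    have h4 := D.asymm _ _ h3
    ext f
    rw [Ideal.mem_inf, Ideal.mem_inf, mem_edgeIdeal, mem_varPowIdeal, mem_varPowIdeal,
      mem_varPowIdeal, ← forall₂_and, ← forall₂_and]
    refine forall₂_congr fun m _ => ?_
    rw [arc_iff_of_path hV h1 h2]
    simp only [h3, h4, true_and, false_and, or_false]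
    omega
  · refine isCohenMacaulayRing_and_isUnmixedIdeal_of_eq_inf hxy hxz hyz hV (i := 1) (j := 1)
      (k := 1) (l := D.weight z) (m := D.weight y) (n := 1) ?_
    have h4 := D.asymm _ _ h3
    ext f
    rw [Ideal.mem_inf, Ideal.mem_inf, mem_edgeIdeal, mem_varPowIdeal, mem_varPowIdeal,
      mem_varPowIdeal, ← forall₂_and, ← forall₂_and]
    refine forall₂_congr fun m _ => ?_
    rw [arc_iff_of_path hV h1 h2]
    simp only [h3, h4, true_and, false_and, false_or, ha]
    omega

/-- If no vertex of the triangle has weight one, then no vertex is a source, and the monomial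
`∏ x_v ^ (w(v) - 1)` lies outside the edge ideal but is multiplied into it by every variable. -/
theorem not_isCohenMacaulayRing_and_not_isUnmixedIdeal_edgeIdeal
    (hC : Nonempty (D.underlying ≃g SimpleGraph.cycleGraph 3))
    (hsource : ∀ v, D.IsSource v → D.weight v = 1) (hw : ∀ v, D.weight v ≠ 1) :
    ¬ IsCohenMacaulayRing (MvPolynomial V K ⧸ D.edgeIdeal K) ∧
      ¬ IsUnmixedIdeal (D.edgeIdeal K) := by
  classical
  have : Finite V := hC.elim fun e => Finite.of_equiv _ e.toEquiv.symm
  have := Fintype.ofFinite V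
  obtain ⟨x, y, z, hxy, hxz, hyz, hV, h1, h2, -⟩ :=
    exists_path hC (hC.some.symm 0)
  have hin : ∀ v, ∃ u, D.Arc u v := by
    intro v
    by_contra! h
    obtain ⟨u, -, hu, -⟩ := exists_triangle hC v
    refine hw v (hsource v ⟨⟨u, ?_⟩, fun u hu => hu.resolve_left (h u)⟩)
    exact arc_or_arc hC hu.symm
  let s : V →₀ ℕ := Finsupp.equivFunOnFinite.symm fun v => D.weight v - 1
  have hs : ∀ v, s v = D.weight v - 1 := fun v => rfl
  have hpos := D.weight_pos
  have hg : (monomial s 1 : MvPolynomial V K) ∉ D.edgeIdeal K := by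
    rw [mem_edgeIdeal]
    intro h
    obtain ⟨u, v, -, -, h⟩ := h s (by simp [mem_support_iff])
    have := hpos v
    rw [hs] at h
    omega
  have hM : ∀ f ∈ idealOfVars V K, f * monomial s 1 ∈ D.edgeIdeal K := by
    intro f hf
    refine Submodule.span_induction (p := fun f _ => f * monomial s 1 ∈ D.edgeIdeal K)
      ?_ ?_ ?_ ?_ hf
    · rintro _ ⟨v, rfl⟩
      obtain ⟨u, huv⟩ := hin v
      have hne : u ≠ v := by rintro rfl; exact D.asymm u u huv huv
      rw [X, monomial_mul, mem_edgeIdeal]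
      intro m hm
      obtain rfl := Finset.mem_singleton.mp (support_monomial_subset hm)
      refine ⟨u, v, huv, ?_, ?_⟩
      · have := hpos u
        have := hw u
        rw [Finsupp.add_apply, hs]
        omega
      · rw [Finsupp.add_apply, hs, Finsupp.single_eq_same]
        omega
    · rw [zero_mul]
      exact Ideal.zero_mem _
    · intro f g _ _ hf hg
      rw [add_mul]
      exact Ideal.add_mem _ hf hg
    · intro c f _ hf
      rw [smul_eq_mul, mul_assoc]
      exact Ideal.mul_mem_left _ c hf
  have hle : D.edgeIdeal K ≤ varPowIdeal K x y 1 1 := by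
    intro f hf
    rw [mem_edgeIdeal] at hf
    rw [mem_varPowIdeal]
    intro m hm
    have hx := hpos x
    have hy := hpos y
    have := (arc_iff_of_path hV h1 h2).mp (hf m hm)
    omega
  have := isPrime_varPowIdeal (K := K) hxz hyz
  have hlt := varPowIdeal_lt_idealOfVars (K := K) hxz hyz
  exact ⟨not_isCohenMacaulayRing_quotient hle hlt hg hM, not_isUnmixedIdeal hle hlt hg hM⟩

end Triangle

/-- The edge ideal of the underlying graph is the edge ideal for the constant weight one. -/
theorem edgeIdeal_underlying :
    D.underlying.edgeIdeal K =
      WeightedOrientedGraph.edgeIdeal ⟨D.Arc, D.asymm, fun _ => 1, fun _ => one_pos⟩ K := by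
  unfold SimpleGraph.edgeIdeal edgeIdeal
  congr 1
  ext f
  simp only [pow_one]
  constructor
  · rintro ⟨u, v, h | h, rfl⟩
    · exact ⟨u, v, h, rfl⟩
    · exact ⟨v, u, h, mul_comm _ _⟩
  · rintro ⟨u, v, h, rfl⟩
    exact ⟨u, v, .inl h, rfl⟩

end WeightedOrientedGraph

theorem theorem4p3 {K : Type*} [Field K] {V : Type*} (D : WeightedOrientedGraph V)
    (hC : Nonempty (D.underlying ≃g SimpleGraph.cycleGraph 3))
    (hsource : ∀ v, D.IsSource v → D.weight v = 1) :
    (IsCohenMacaulayRing (MvPolynomial V K ⧸ D.edgeIdeal K) ↔ ∃ v, D.weight v = 1) ∧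
    (IsCohenMacaulayRing (MvPolynomial V K ⧸ D.edgeIdeal K) ↔
      IsUnmixedIdeal (D.edgeIdeal K) ∧
        IsCohenMacaulayRing (MvPolynomial V K ⧸ D.underlying.edgeIdeal K)) := by
  have hG : IsCohenMacaulayRing (MvPolynomial V K ⧸ D.underlying.edgeIdeal K) := by
    rw [D.edgeIdeal_underlying]
    exact (WeightedOrientedGraph.isCohenMacaulayRing_and_isUnmixedIdeal_edgeIdeal
      (D := ⟨D.Arc, D.asymm, fun _ => 1, fun _ => one_pos⟩) hC (a := hC.some.symm 0) rfl).1
  by_cases h : ∃ v, D.weight v = 1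
  · obtain ⟨a, ha⟩ := h
    obtain ⟨h1, h2⟩ :=
      WeightedOrientedGraph.isCohenMacaulayRing_and_isUnmixedIdeal_edgeIdeal (K := K) hC ha
    exact ⟨iff_of_true h1 ⟨a, ha⟩, iff_of_true h1 ⟨h2, hG⟩⟩
  · obtain ⟨h1, h2⟩ :=
      WeightedOrientedGraph.not_isCohenMacaulayRing_and_not_isUnmixedIdeal_edgeIdeal (K := K) hC
        hsource (not_exists.mp h)
    exact ⟨iff_of_false h1 h, iff_of_false h1 fun h3 => h2 h3.1⟩
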